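/- **Theorem.** Let $(\mathcal M,g)$ be a smooth Riemannian manifold of real dimension $n$ with Levi-Civita connection $\nabla$, and let $A$ be a smooth $(1,1)$-tensor field such that $(\mathcal M,g,A)$ is a Kähler manifold, i.e. $A^2=-I$, $g(AX,AY)=g(X,Y)$ and $\nabla A=0$. For a smooth 1-form $\pi$ let $\overset{1}{\nabla}$ be the quarter-symmetric metric $A$-connection with generator $\pi$, $$\overset{1}{\nabla}_XY=\nabla_XY-\pi(X)AY,$$ let $\overset{2}{\nabla}_XY=\overset{1}{\nabla}_YX+[X,Y]$ be its dual connection, and let $$\overset{4}{R}(X,Y)Z=\overset{2}{\nabla}_X\overset{1}{\nabla}_YZ-\overset{1}{\nabla}_Y\overset{2}{\nabla}_XZ+\overset{2}{\nabla}_{\overset{2}{\nabla}_YX}Z-\overset{1}{\nabla}_{\overset{1}{\nabla}_XY}Z$$ be its curvature tensor of the fourth kind, with the contractions $$\overset{4}{R}ic(Y,Z)=\mathrm{Trace}\{X\mapsto\overset{4}{R}(X,Y)Z\},\qquad \overset{4}{'R}(X,Y)=\mathrm{Trace}\{Z\mapsto\overset{4}{R}(X,Y)Z\}.$$ For smooth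 vector fields $X,Y,Z$ put $$\overset{4}{H}(X,Y)Z=\overset{4}{R}(X,Y)Z-\overset{4}{'R}(AY,X)AZ+\overset{4}{'R}(AZ,Y)AX-\frac1{n-1}\Big(\overset{4}{R}ic(Y,Z)X-\overset{4}{R}ic(X,Z)Y-\overset{4}{'R}(AY,AZ)X+\overset{4}{'R}(AX,AZ)Y\Big).$$ Then $\overset{4}{H}$ is independent of the generator: any two smooth 1-forms $\pi,\pi'$ give the same $\overset{4}{H}(X,Y)Z$ for all smooth $X,Y,Z$. Moreover, $\overset{4}{H}$ equals the Weyl projective curvature tensor of $g$: $$\overset{4}{H}(X,Y)Z=\overset{g}{W}(X,Y)Z=\overset{g}{R}(X,Y)Z+\frac1{n-1}\Big(\overset{g}{R}ic(X,Z)Y-\overset{g}{R}ic(Y,Z)X\Big),$$ where $\overset{g}{R}(X,Y)Z=\nabla_X\nabla_YZ-\nabla_Y\nabla_XZ-\nabla_{[X,Y]}Z$ and $\overset{g}{R}ic(Y,Z)=\mathrm{Trace}\{X\mapsto\overset{g}{R}(X,Y)Z\}$. -/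

import Mathlib

open Bundle
open scoped Manifold ContDiff

noncomputable section

namespace QuarterSymmetric

variable {E : Type*} [NormedAddCommGroup E] [NormedSpace ℝ E]
  {H : Type*} [TopologicalSpace H] {I : ModelWithCorners ℝ E H}
  {M : Type*} [TopologicalSpace M] [ChartedSpace H M]

/-! ### Vector fields, tensor fields of type (1,1) and 1-forms -/

variable (I M) in
/-- Vector fields (with no regularity imposed). -/
abbrev VField : Type _ := Π x : M, TangentSpace I x

variable (I M) in
/-- Fields of endomorphisms of the tangent spaces (with no regularity imposed). -/
abbrev EndField : Type _ := Π x : M, TangentSpace I x →L[ℝ] TangentSpace I x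

variable (I M) in
/-- Fields of covectors (with no regularity imposed). -/
abbrev CovField : Type _ := Π x : M, TangentSpace I x →L[ℝ] ℝ

/-- `X` is a smooth vector field. -/
def SmoothVField [IsManifold I 1 M] (X : VField I M) : Prop :=
  ContMDiff I (I.prod 𝓘(ℝ, E)) ∞
    (fun x ↦ TotalSpace.mk' E (E := fun y : M ↦ TangentSpace I y) x (X x))

/-- `A` is a smooth tensor field of type (1,1). -/
def SmoothEndField [IsManifold I 1 M] (A : EndField I M) : Prop :=
  ContMDiff I (I.prod 𝓘(ℝ, E →L[ℝ] E)) ∞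
    (fun x ↦ TotalSpace.mk' (E →L[ℝ] E)
      (E := fun y : M ↦ TangentSpace I y →L[ℝ] TangentSpace I y) x (A x))

/-- `η` is a smooth 1-form. -/
def SmoothOneForm [IsManifold I 1 M] (η : CovField I M) : Prop :=
  ContMDiff I (I.prod 𝓘(ℝ, E →L[ℝ] ℝ)) ∞
    (fun x ↦ TotalSpace.mk' (E →L[ℝ] ℝ)
      (E := fun y : M ↦ TangentSpace I y →L[ℝ] Bundle.Trivial M ℝ y) x (η x))

/-- The vector field `A X`. -/
def applyField (A : EndField I M) (X : VField I M) : VField I M := fun x ↦ A x (X x)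

/-! ### Linear connections -/

variable (I M) in
/-- Linear connections, i.e. covariant derivatives on the tangent bundle. -/
abbrev LinConnection [IsManifold I 1 M] : Type _ :=
  CovariantDerivative I E (fun x : M ↦ TangentSpace I x)

/-- The vector field `∇_X Y`. -/
def nabla [IsManifold I 1 M] (D : LinConnection I M) (X Y : VField I M) : VField I M :=
  fun x ↦ D Y x (X x)

/-- The connection `∇¹_X Y = ∇_X Y - η(X) A Y`, with generator `η`. -/
def quarterSymmetric [IsManifold I 1 M] (D : LinConnection I M) (A : EndField I M)
    (η : CovField I M) : LinConnection I M where
  toFun Y x := D Y x - (η x).smulRight (A x (Y x))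
  isCovariantDerivativeOnUniv :=
    { add := by
        intro Y Y' x hY hY' _
        ext v
        simp [D.isCovariantDerivativeOnUniv.add hY hY']
        abel
      leibniz := by
        intro Y f x hY hf _
        ext v
        simp [D.isCovariantDerivativeOnUniv.leibniz hY hf]
        module }

section

variable [FiniteDimensional ℝ E] [IsManifold I 2 M]

/-- The dual (conjugate) connection `∇²` of a linear connection `∇¹` with torsion `T¹`:
`∇²_X Y = ∇¹_X Y - T¹(X, Y) = ∇¹_X Y + T¹(Y, X)`. -/
def dual (D : LinConnection I M) : LinConnection I M :=
  haveI : CompleteSpace E := FiniteDimensional.complete ℝ E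
  D.addOneForm (fun x ↦ CovariantDerivative.torsion D x)

/-- The defining property `∇²_X Y = ∇¹_Y X + [X, Y]` of the dual connection. -/
theorem nabla_dual (D : LinConnection I M) {X Y : VField I M} {x : M}
    (hX : MDifferentiableAt I (I.prod 𝓘(ℝ, E))
      (fun x ↦ TotalSpace.mk' E (E := fun y : M ↦ TangentSpace I y) x (X x)) x)
    (hY : MDifferentiableAt I (I.prod 𝓘(ℝ, E))
      (fun x ↦ TotalSpace.mk' E (E := fun y : M ↦ TangentSpace I y) x (Y x)) x) :
    nabla (dual D) X Y x = nabla D Y X x + VectorField.mlieBracket I X Y x := by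
  have : CompleteSpace E := FiniteDimensional.complete ℝ E
  have h := CovariantDerivative.torsion_apply D hY hX
  have h2 := VectorField.mlieBracket_swap (I := I) (V := X) (W := Y)
  simp only [nabla, dual, CovariantDerivative.addOneForm] at *
  simp only [add_apply]
  rw [h, h2]
  simp only [Pi.neg_apply]
  abel

end

/-! ### Curvature tensors -/

/-- The curvature `R(X,Y)Z = ∇_X ∇_Y Z - ∇_Y ∇_X Z - ∇_{[X,Y]} Z` of a linear connection. -/
def curvature [IsManifold I 1 M] (D : LinConnection I M) (X Y Z : VField I M) : VField I M :=
  nabla D X (nabla D Y Z) - nabla D Y (nabla D X Z)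
    - nabla D (VectorField.mlieBracket I X Y) Z

/-- The curvature tensor of the fourth kind of a linear connection `∇¹` with dual `∇²`:
`R⁴(X,Y)Z = ∇²_X ∇¹_Y Z - ∇¹_Y ∇²_X Z + ∇²_{∇²_Y X} Z - ∇¹_{∇¹_X Y} Z`. -/
def curvature4 [FiniteDimensional ℝ E] [IsManifold I 2 M] (D : LinConnection I M)
    (X Y Z : VField I M) : VField I M :=
  nabla (dual D) X (nabla D Y Z) - nabla D Y (nabla (dual D) X Z)
    + nabla (dual D) (nabla (dual D) Y X) Z - nabla D (nabla D X Y) Z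

/-- The trace at `x` of an operation `Φ` on vector fields for which `Φ(U)` at `x` depends linearly
on the value of `U` at `x` only, i.e. the trace of the endomorphism `U(x) ↦ Φ(U)(x)` of the
tangent space at `x` (see `traceAt_eq`). The endomorphism is prescribed on a basis. -/
def traceAt [FiniteDimensional ℝ E] [IsManifold I 1 M] (Φ : VField I M → VField I M) (x : M) : ℝ :=
  haveI : FiniteDimensional ℝ (TangentSpace I x) := inferInstanceAs (FiniteDimensional ℝ E)
  LinearMap.trace ℝ (TangentSpace I x)
    ((Module.finBasis ℝ (TangentSpace I x)).constr ℝ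
      fun i ↦ Φ (FiberBundle.extend E (Module.finBasis ℝ (TangentSpace I x) i)) x)

theorem traceAt_eq [FiniteDimensional ℝ E] [IsManifold I ∞ M] (Φ : VField I M → VField I M) (x : M)
    (L : TangentSpace I x →ₗ[ℝ] TangentSpace I x)
    (hL : ∀ U : VField I M, ContMDiffAt I (I.prod 𝓘(ℝ, E)) ∞
      (fun x ↦ TotalSpace.mk' E (E := fun y : M ↦ TangentSpace I y) x (U x)) x →
        Φ U x = L (U x)) :
    traceAt Φ x = LinearMap.trace ℝ (TangentSpace I x) L := by
  have : FiniteDimensional ℝ (TangentSpace I x) := inferInstanceAs (FiniteDimensional ℝ E)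
  unfold traceAt
  congr 1
  refine (Module.finBasis ℝ (TangentSpace I x)).ext fun i ↦ ?_
  rw [Module.Basis.constr_basis, hL _ (FiberBundle.contMDiffAt_extend I E _)]
  simp

/-- The Ricci tensor `Ric(Y,Z) = Trace {X ↦ R(X,Y)Z}` of a curvature operator `R`. -/
def ricci [FiniteDimensional ℝ E] [IsManifold I 1 M]
    (R : VField I M → VField I M → VField I M → VField I M) (Y Z : VField I M) : M → ℝ :=
  traceAt fun X ↦ R X Y Z

/-- The contraction `'R(X,Y) = Trace {Z ↦ R(X,Y)Z}` of a curvature operator `R`. -/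
def primeContraction [FiniteDimensional ℝ E] [IsManifold I 1 M]
    (R : VField I M → VField I M → VField I M → VField I M) (X Y : VField I M) : M → ℝ :=
  traceAt fun Z ↦ R X Y Z

/-- The Weyl projective curvature tensor
`W(X,Y)Z = R(X,Y)Z + 1/(n-1) (Ric(X,Z) Y - Ric(Y,Z) X)` in dimension `n`. -/
def weylProjective [FiniteDimensional ℝ E] [IsManifold I 1 M] (D : LinConnection I M)
    (X Y Z : VField I M) : VField I M :=
  curvature D X Y Z
    + (1 / ((Module.finrank ℝ E : ℝ) - 1)) •
      (ricci (curvature D) X Z • Y - ricci (curvature D) Y Z • X)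

/-- The tensor `H⁴` of a linear connection `∇¹` and a tensor field `A`, in dimension `n`:
`H⁴(X,Y)Z = R⁴(X,Y)Z - 'R⁴(AY,X) AZ + 'R⁴(AZ,Y) AX`
`- 1/(n-1) (Ric⁴(Y,Z) X - Ric⁴(X,Z) Y - 'R⁴(AY,AZ) X + 'R⁴(AX,AZ) Y)`. -/
def tensorH4 [FiniteDimensional ℝ E] [IsManifold I 2 M] (D : LinConnection I M) (A : EndField I M)
    (X Y Z : VField I M) : VField I M :=
  curvature4 D X Y Z
    - primeContraction (curvature4 D) (applyField A Y) X • applyField A Z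
    + primeContraction (curvature4 D) (applyField A Z) Y • applyField A X
    - (1 / ((Module.finrank ℝ E : ℝ) - 1)) •
      (ricci (curvature4 D) Y Z • X - ricci (curvature4 D) X Z • Y
        - primeContraction (curvature4 D) (applyField A Y) (applyField A Z) • X
        + primeContraction (curvature4 D) (applyField A X) (applyField A Z) • Y)

/-! ### Kähler manifolds -/

section

variable [FiniteDimensional ℝ E] [IsManifold I ∞ M]
  [RiemannianBundle (fun x : M ↦ TangentSpace I x)]
  [IsContMDiffRiemannianBundle I ∞ E (fun x : M ↦ TangentSpace I x)]

/-- `D` is the Levi-Civita connection of the Riemannian metric: smooth, metric, torsion-free. -/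
structure IsLeviCivita (D : LinConnection I M) : Prop where
  smooth : CovariantDerivative.ContMDiffCovariantDerivative D ∞
  metric : CovariantDerivative.IsMetricCompatible (I := I) (F := E)
    (V := fun x : M ↦ TangentSpace I x) (by exact D)
  torsion_eq_zero :
    haveI : CompleteSpace E := FiniteDimensional.complete ℝ E
    CovariantDerivative.torsion D = 0

/-- `A` is a smooth almost complex structure compatible with the Riemannian metric. -/
structure IsAlmostHermitian (A : EndField I M) : Prop where
  smooth : SmoothEndField A
  sq_eq_neg : ∀ (x : M) (v : TangentSpace I x), A x (A x v) = -v
  inner_eq : ∀ (x : M) (v w : TangentSpace I x), inner ℝ (A x v) (A x w) = inner ℝ v w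

/-- The almost Hermitian manifold with Levi-Civita connection `D` and almost complex structure `A`
is a Kähler manifold: `(∇_X A) Y = ∇_X (A Y) - A (∇_X Y) = 0`. -/
structure IsKahler (D : LinConnection I M) (A : EndField I M) : Prop where
  leviCivita : IsLeviCivita D
  almostHermitian : IsAlmostHermitian A
  parallel : ∀ X Y : VField I M, SmoothVField X → SmoothVField Y →
    nabla D X (applyField A Y) = applyField A (nabla D X Y)

end

end QuarterSymmetric

end

open Bundle Filter Topology
open scoped Manifold ContDiff

noncomputable section

namespace QuarterSymmetric

variable {E : Type*} [NormedAddCommGroup E] [NormedSpace ℝ E]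
  {H : Type*} [TopologicalSpace H] {I : ModelWithCorners ℝ E H}
  {M : Type*} [TopologicalSpace M] [ChartedSpace H M]

/-! ### Smooth vector fields -/

section Smooth

variable [IsManifold I ∞ M]

/-! Everything rests on one formula. Put S(v,w) = (∇_v η)(w) + η(v) η(Aw) (`formS`). Since ∇ is
torsion-free, ∇A = 0 and A² = -1, the curvature of the fourth kind is R⁴(X,Y)Z = R(X,Y)Z - S(X,Y) AZ
+ S(Y,Z) AX + η(Y)η(Z) X - η(X)η(Z) Y (`curvature4_quarterSymmetric`).

Both R(X,Y) and A are skew for the metric, hence trace-free, so the contractions are 'R⁴(X,Y) =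
S(Y,AX) (`primeContraction_curvature4`) and Ric⁴(Y,Z) = Ric(Y,Z) - S(AZ,Y) + (n-1) η(Y)η(Z)
(`ricci_curvature4`). Thus 'R⁴(AY,X) = -S(X,Y) recovers S, and Ric⁴(Y,Z) - 'R⁴(AY,AZ) = Ric(Y,Z) +
(n-1) η(Y)η(Z) recovers η ⊗ η. Eliminating S and η ⊗ η from the formula leaves the Weyl tensor of ∇,
which does not involve η. Division by n-1 is legitimate because A² = -1 forces n to be even.

The analytic work lies in the skewness of R(X,Y), via [X,Y]f = XYf - YXf, and in evaluating traces,
which are defined through local extensions of basis vectors. -/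

theorem SmoothVField.mdifferentiableAt {X : VField I M} (hX : SmoothVField X) (x : M) :
    MDifferentiableAt I (I.prod 𝓘(ℝ, E))
      (fun x ↦ TotalSpace.mk' E (E := fun y : M ↦ TangentSpace I y) x (X x)) x :=
  (ContMDiff.contMDiffAt hX).mdifferentiableAt (by simp)

theorem SmoothVField.sub {X Y : VField I M} (hX : SmoothVField X) (hY : SmoothVField Y) :
    SmoothVField (X - Y) :=
  ContMDiff.sub_section hX hY

theorem SmoothVField.smul {f : M → ℝ} {X : VField I M} (hX : SmoothVField X)
    (hf : ContMDiff I 𝓘(ℝ) ∞ f) : SmoothVField (f • X) :=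
  ContMDiff.smul_section hf hX

theorem SmoothEndField.applyField {A : EndField I M} {X : VField I M} (hA : SmoothEndField A)
    (hX : SmoothVField X) : SmoothVField (applyField A X) :=
  ContMDiff.clm_bundle_apply (E₁ := fun y : M ↦ TangentSpace I y)
    (E₂ := fun y : M ↦ TangentSpace I y) (b := id) hA hX

theorem SmoothOneForm.contMDiff_apply {η : CovField I M} {X : VField I M} (hη : SmoothOneForm η)
    (hX : SmoothVField X) : ContMDiff I 𝓘(ℝ) ∞ (fun x ↦ η x (X x)) := by
  intro x
  have h := (ContMDiff.clm_bundle_apply (E₁ := fun y : M ↦ TangentSpace I y)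
    (E₂ := Bundle.Trivial M ℝ) (b := id) hη hX) x
  exact (contMDiffAt_totalSpace.1 h).2

theorem SmoothOneForm.mdifferentiableAt_apply {η : CovField I M} {Y : VField I M} {x : M}
    (hη : SmoothOneForm η) (hY : MDifferentiableAt I (I.prod 𝓘(ℝ, E))
      (fun x ↦ TotalSpace.mk' E (E := fun y : M ↦ TangentSpace I y) x (Y x)) x) :
    MDifferentiableAt I 𝓘(ℝ) (fun x ↦ η x (Y x)) x := by
  have hη' := (ContMDiff.contMDiffAt hη (x := x)).mdifferentiableAt (by simp)
  have h := MDifferentiableAt.clm_bundle_apply (E₁ := fun y : M ↦ TangentSpace I y)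
    (E₂ := Bundle.Trivial M ℝ) (b := id) hη' hY
  exact ((mdifferentiableAt_totalSpace _ _).1 h).2

theorem SmoothVField.mlieBracket [CompleteSpace E] {X Y : VField I M} (hX : SmoothVField X)
    (hY : SmoothVField Y) : SmoothVField (VectorField.mlieBracket I X Y) := by
  -- The bracket costs one derivative, which is harmless since ∞ + 1 = ∞.
  have : IsManifold I (((⊤ : ℕ∞) : WithTop ℕ∞) + 1) M := by simpa using ‹IsManifold I ∞ M›
  have : IsManifold I (minSmoothness ℝ 2) M := by
    rw [minSmoothness_of_isRCLikeNormedField]; infer_instance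
  exact ContDiff.mlieBracket_vectorField (n := ⊤) (m := ⊤) hX hY (by simp)

/-- The local extension is smooth near x only; a bump function supported there and equal to 1 near x
makes it globally smooth without changing its germ. -/
theorem exists_smoothVField_eventuallyEq_extend [FiniteDimensional ℝ E] [T2Space M] {x : M}
    (v : TangentSpace I x) :
    ∃ U : VField I M, SmoothVField U ∧
      U =ᶠ[𝓝 x] FiberBundle.extend E (E := fun y : M ↦ TangentSpace I y) v := by
  obtain ⟨s, hs, hv⟩ := FiberBundle.exists_contMDiffOn_extend (k := ∞) I E v
  obtain ⟨f, -, hf⟩ := ((SmoothBumpFunction.nhds_basis_tsupport (I := I) x).mem_iff).1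
    (interior_mem_nhds.2 hs)
  refine ⟨(f : M → ℝ) • FiberBundle.extend E (E := fun y : M ↦ TangentSpace I y) v, ?_, ?_⟩
  · exact ContMDiffOn.smul_section_of_tsupport f.contMDiff.contMDiffOn isOpen_interior hf
      (hv.mono interior_subset)
  · filter_upwards [f.eventuallyEq_one] with y hy
    rw [Pi.smul_apply', hy, Pi.one_apply, one_smul]

theorem exists_smoothVField_apply_eq [FiniteDimensional ℝ E] [T2Space M] {x : M}
    (v : TangentSpace I x) : ∃ U : VField I M, SmoothVField U ∧ U x = v := by
  obtain ⟨U, hU, h⟩ := exists_smoothVField_eventuallyEq_extend v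
  exact ⟨U, hU, h.self_of_nhds.trans (FiberBundle.extend_apply_self E v)⟩

/-- The Lie bracket of vector fields is the commutator of the derivations they define. -/
theorem mvfderiv_mlieBracket [FiniteDimensional ℝ E] [T2Space M] {X Y : VField I M}
    (hX : SmoothVField X) (hY : SmoothVField Y) {f : M → ℝ} (hf : ContMDiff I 𝓘(ℝ) ∞ f)
    (hXf : ContMDiff I 𝓘(ℝ) ∞ fun y ↦ mvfderiv I f y (X y))
    (hYf : ContMDiff I 𝓘(ℝ) ∞ fun y ↦ mvfderiv I f y (Y y)) (x : M) :
    mvfderiv I f x (VectorField.mlieBracket I X Y x) =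
      mvfderiv I (fun y ↦ mvfderiv I f y (Y y)) x (X x) -
        mvfderiv I (fun y ↦ mvfderiv I f y (X y)) x (Y x) := by
  have : CompleteSpace E := FiniteDimensional.complete ℝ E
  have hm2 : minSmoothness ℝ 2 = 2 := by simp
  have hm3 : minSmoothness ℝ 3 = 3 := by simp
  have : IsManifold I (minSmoothness ℝ 3) M := by
    rw [hm3]; exact IsManifold.of_le (n := ∞) ENat.LEInfty.out
  have hle (V : VField I M) (hV : SmoothVField V) : ContMDiffAt I (I.prod 𝓘(ℝ, E))
      (minSmoothness ℝ 2)
      (fun x ↦ TotalSpace.mk' E (E := fun y : M ↦ TangentSpace I y) x (V x)) x := by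
    rw [hm2]
    exact (ContMDiff.contMDiffAt hV).of_le ENat.LEInfty.out
  have hmd {g : M → ℝ} (hg : ContMDiff I 𝓘(ℝ) ∞ g) (y : M) : MDifferentiableAt I 𝓘(ℝ) g y :=
    hg.contMDiffAt.mdifferentiableAt (by simp)
  -- Jacobi for X, Y, fW, expanded by the Leibniz rule, minus f times Jacobi for X, Y, W: the
  -- first-order terms cancel and only the commutator defect times W remains. A field W with W x ≠ 0
  -- then finishes.
  have key (W : VField I M) (hW : SmoothVField W) :
      (mvfderiv I (fun y ↦ mvfderiv I f y (Y y)) x (X x) -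
        mvfderiv I (fun y ↦ mvfderiv I f y (X y)) x (Y x) -
        mvfderiv I f x (VectorField.mlieBracket I X Y x)) • W x = 0 := by
    have hb {V : VField I M} : VectorField.mlieBracket I V (f • W) =
        (fun y ↦ mvfderiv I f y (V y)) • W + f • VectorField.mlieBracket I V W := by
      ext y
      exact VectorField.mlieBracket_smul_right (hmd hf y) (hW.mdifferentiableAt y)
    have hb' {V V' : VField I M} (hV : SmoothVField V)
        (hVf : ContMDiff I 𝓘(ℝ) ∞ fun y ↦ mvfderiv I f y (V y)) :
        VectorField.mlieBracket I V' (VectorField.mlieBracket I V (f • W)) x =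
        mvfderiv I (fun y ↦ mvfderiv I f y (V y)) x (V' x) • W x +
          mvfderiv I f x (V x) • VectorField.mlieBracket I V' W x +
          (mvfderiv I f x (V' x) • VectorField.mlieBracket I V W x +
          f x • VectorField.mlieBracket I V' (VectorField.mlieBracket I V W) x) := by
      rw [hb, VectorField.mlieBracket_add_right ((hW.smul hVf).mdifferentiableAt x)
        (((hV.mlieBracket hW).smul hf).mdifferentiableAt x),
        VectorField.mlieBracket_smul_right (hmd hVf x) (hW.mdifferentiableAt x),
        VectorField.mlieBracket_smul_right (hmd hf x) ((hV.mlieBracket hW).mdifferentiableAt x)]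
    have h := VectorField.leibniz_identity_mlieBracket_apply (hle X hX) (hle Y hY)
      (hle _ (hW.smul hf))
    have h' := VectorField.leibniz_identity_mlieBracket_apply (hle X hX) (hle Y hY) (hle W hW)
    rw [hb' hY hYf, hb' hX hXf, hb, h'] at h
    simp only [Pi.add_apply, Pi.smul_apply'] at h
    rw [← sub_eq_zero] at h
    rw [← h]
    module
  rcases subsingleton_or_nontrivial (TangentSpace I x) with h | h
  · simp [Subsingleton.elim (X x) 0, Subsingleton.elim (Y x) 0,
      Subsingleton.elim (VectorField.mlieBracket I X Y x) 0]
  · obtain ⟨v, hv⟩ := exists_ne (0 : TangentSpace I x)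
    obtain ⟨W, hW, rfl⟩ := exists_smoothVField_apply_eq v
    have := (smul_eq_zero.1 (key W hW)).resolve_right hv
    linarith

end Smooth

/-! ### Calculus of linear connections -/

section Connection

variable [IsManifold I ∞ M] (D : LinConnection I M)

theorem nabla_add_right (X : VField I M) {Y Z : VField I M} (hY : SmoothVField Y)
    (hZ : SmoothVField Z) : nabla D X (Y + Z) = nabla D X Y + nabla D X Z := by
  ext x
  simp [nabla, D.isCovariantDerivativeOnUniv.add (hY.mdifferentiableAt x) (hZ.mdifferentiableAt x)]

theorem nabla_smul_right (X : VField I M) {f : M → ℝ} {Y : VField I M}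
    (hf : ContMDiff I 𝓘(ℝ) ∞ f) (hY : SmoothVField Y) :
    nabla D X (f • Y) = f • nabla D X Y + (fun x ↦ mvfderiv I f x (X x)) • Y := by
  ext x
  simp [nabla, D.isCovariantDerivativeOnUniv.leibniz (hY.mdifferentiableAt x)
    (hf.contMDiffAt.mdifferentiableAt (by simp))]

theorem nabla_sub_right (X : VField I M) {Y Z : VField I M} (hY : SmoothVField Y)
    (hZ : SmoothVField Z) : nabla D X (Y - Z) = nabla D X Y - nabla D X Z := by
  have h := nabla_add_right D X (hY.sub hZ) hZ
  rw [sub_add_cancel] at h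
  rw [h, add_sub_cancel_right]

variable {D} in
theorem nabla_smooth (hD : CovariantDerivative.ContMDiffCovariantDerivative D ∞) {X Y : VField I M}
    (hX : SmoothVField X) (hY : SmoothVField Y) : SmoothVField (nabla D X Y) := by
  have h := contMDiffOn_univ.1 (hD.contMDiff.contMDiff (σ := Y)
    (contMDiffOn_univ.2 (by simpa using! hY)))
  exact ContMDiff.clm_bundle_apply (E₁ := fun y : M ↦ TangentSpace I y)
    (E₂ := fun y : M ↦ TangentSpace I y) (b := id) h hX

/-- The conclusion is again an equality of germs, so that it can be iterated through nested
covariant derivatives. -/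
theorem nabla_congr {X X' Y Y' : VField I M} {x : M} (hY : SmoothVField Y') (hXX' : X =ᶠ[𝓝 x] X')
    (hYY' : Y =ᶠ[𝓝 x] Y') : nabla D X Y =ᶠ[𝓝 x] nabla D X' Y' := by
  filter_upwards [hXX', hYY'.eventuallyEq_nhds] with y hXy hYy
  have h' := hY.mdifferentiableAt y
  have h : MDifferentiableAt I (I.prod 𝓘(ℝ, E))
      (fun x ↦ TotalSpace.mk' E (E := fun y : M ↦ TangentSpace I y) x (Y x)) y :=
    h'.congr_of_eventuallyEq (by filter_upwards [hYy] with z hz; rw [hz])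
  rw [nabla, nabla, hXy, D.isCovariantDerivativeOnUniv.congr_of_eventuallyEq h h' univ_mem hYy]

end Connection

/-! ### Traces -/

section Trace

theorem trace_eq_zero_of_skew {V : Type*} [NormedAddCommGroup V] [InnerProductSpace ℝ V]
    [FiniteDimensional ℝ V] (L : V →ₗ[ℝ] V) (hL : ∀ v w, inner ℝ (L v) w = -inner ℝ v (L w)) :
    LinearMap.trace ℝ V L = 0 := by
  rw [LinearMap.trace_eq_sum_inner L (stdOrthonormalBasis ℝ V)]
  refine Finset.sum_eq_zero fun i _ ↦ ?_
  have h := hL (stdOrthonormalBasis ℝ V i) (stdOrthonormalBasis ℝ V i)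
  rw [real_inner_comm] at h
  linarith

/-- `traceAt` prescribes its endomorphism on a basis that need not be orthonormal; by bilinearity,
skewness may be tested there. -/
theorem skew_of_basis {V ι : Type*} [NormedAddCommGroup V] [InnerProductSpace ℝ V]
    (b : Module.Basis ι ℝ V) (L : V →ₗ[ℝ] V)
    (hL : ∀ i j, inner ℝ (L (b i)) (b j) = -inner ℝ (b i) (L (b j))) (v w : V) :
    inner ℝ (L v) w = -inner ℝ v (L w) := by
  have h : (innerₗ V).compl₁₂ L LinearMap.id = -(innerₗ V).compl₁₂ LinearMap.id L :=
    b.ext fun i ↦ b.ext fun j ↦ by simpa using hL i j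
  simpa using congr($h v w)

/-- Taking determinants gives (det L)² = (-1)^n, which cannot be negative. -/
theorem even_finrank_of_sq_eq_neg {V : Type*} [AddCommGroup V] [Module ℝ V]
    (L : V →ₗ[ℝ] V) (hL : ∀ v, L (L v) = -v) : Even (Module.finrank ℝ V) := by
  have h : L ∘ₗ L = (-1 : ℝ) • LinearMap.id := by ext v; simp [hL]
  have h2 := congr(LinearMap.det $h)
  rw [LinearMap.det_comp, LinearMap.det_smul, LinearMap.det_id, mul_one] at h2
  by_contra hn
  rw [Nat.not_even_iff_odd.1 hn |>.neg_one_pow] at h2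
  nlinarith [mul_self_nonneg (LinearMap.det L)]

variable [IsManifold I ∞ M]

/-- An operation on vector fields is local at `x` if its value there depends only on the germ. -/
def LocalAt (Φ : VField I M → VField I M) (x : M) : Prop :=
  ∀ U U' : VField I M, SmoothVField U' → U =ᶠ[𝓝 x] U' → Φ U x = Φ U' x

variable [FiniteDimensional ℝ E]

/-- Two local operations whose difference is given by an endomorphism `L` of the tangent space have
traces differing by the trace of `L`. -/
theorem traceAt_eq_add [T2Space M] {Φ Ψ : VField I M → VField I M} {x : M} (hΦ : LocalAt Φ x)
    (hΨ : LocalAt Ψ x) (L : TangentSpace I x →ₗ[ℝ] TangentSpace I x)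
    (h : ∀ U : VField I M, SmoothVField U → Φ U x = Ψ U x + L (U x)) :
    traceAt Φ x = traceAt Ψ x + LinearMap.trace ℝ (TangentSpace I x) L := by
  have : FiniteDimensional ℝ (TangentSpace I x) := inferInstanceAs (FiniteDimensional ℝ E)
  unfold traceAt
  rw [← map_add]
  congr 1
  refine (Module.finBasis ℝ (TangentSpace I x)).ext fun i ↦ ?_
  -- The hypothesis `h` speaks of globally smooth fields, the trace of local extensions; locality of
  -- both operations allows the exchange.
  obtain ⟨U, hU, hUe⟩ := exists_smoothVField_eventuallyEq_extend (E := E)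
    (Module.finBasis ℝ (TangentSpace I x) i)
  have hx : U x = Module.finBasis ℝ (TangentSpace I x) i :=
    hUe.self_of_nhds.trans (FiberBundle.extend_apply_self E _)
  rw [LinearMap.add_apply, Module.Basis.constr_basis, Module.Basis.constr_basis,
    hΦ _ U hU hUe.symm, hΨ _ U hU hUe.symm, h U hU, hx]

theorem traceAt_eq_zero_of_skew [T2Space M] [RiemannianBundle (fun x : M ↦ TangentSpace I x)]
    {Φ : VField I M → VField I M} {x : M} (hΦ : LocalAt Φ x)
    (h : ∀ U V : VField I M, SmoothVField U → SmoothVField V →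
      inner ℝ (Φ U x) (V x) = -inner ℝ (U x) (Φ V x)) :
    traceAt Φ x = 0 := by
  have : FiniteDimensional ℝ (TangentSpace I x) := inferInstanceAs (FiniteDimensional ℝ E)
  refine trace_eq_zero_of_skew _ (skew_of_basis (Module.finBasis ℝ (TangentSpace I x)) _ ?_)
  intro i j
  have hex (k) : ∃ U : VField I M, SmoothVField U ∧ U x = Module.finBasis ℝ (TangentSpace I x) k ∧
      Φ (FiberBundle.extend E (Module.finBasis ℝ (TangentSpace I x) k)) x = Φ U x := by
    obtain ⟨U, hU, hUe⟩ := exists_smoothVField_eventuallyEq_extend (E := E)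
      (Module.finBasis ℝ (TangentSpace I x) k)
    exact ⟨U, hU, hUe.self_of_nhds.trans (FiberBundle.extend_apply_self E _), hΦ _ U hU hUe.symm⟩
  obtain ⟨U, hU, hUx, hΦU⟩ := hex i
  obtain ⟨V, hV, hVx, hΦV⟩ := hex j
  rw [Module.Basis.constr_basis, Module.Basis.constr_basis, hΦU, hΦV, ← hUx, ← hVx]
  exact h U V hU hV

end Trace

/-! ### Covariant derivative of a 1-form -/

section OneForm

variable [IsManifold I ∞ M]

/-- Replacing Y by fY, the terms v(f) η(Y) from the two Leibniz rules cancel. Hence ∇_v η is a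
genuine covector at x. -/
theorem tensorialAt_oneForm (D : LinConnection I M) {η : CovField I M} (hη : SmoothOneForm η)
    {x : M} (v : TangentSpace I x) :
    TensorialAt I E (fun Y : VField I M ↦ mvfderiv I (fun y ↦ η y (Y y)) x v - η x (D Y x v)) x where
  smul {f σ} hf hσ := by
    have h : (fun y ↦ η y ((f • σ) y)) = f * fun y ↦ η y (σ y) := by ext y; simp
    rw [h, mvfderiv_mul hf (hη.mdifferentiableAt_apply hσ),
      D.isCovariantDerivativeOnUniv.leibniz hσ hf]
    simp
    ring
  add {σ σ'} hσ hσ' := by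
    have h : (fun y ↦ η y ((σ + σ') y)) = (fun y ↦ η y (σ y)) + fun y ↦ η y (σ' y) := by
      ext y; simp
    rw [h, mvfderiv_add (hη.mdifferentiableAt_apply hσ) (hη.mdifferentiableAt_apply hσ'),
      D.isCovariantDerivativeOnUniv.add hσ hσ']
    simp
    ring

variable [FiniteDimensional ℝ E]

/-- The covector `w ↦ (∇_v η)(w)`. -/
def covDerivOneForm (D : LinConnection I M) {η : CovField I M} (hη : SmoothOneForm η) {x : M}
    (v : TangentSpace I x) : TangentSpace I x →L[ℝ] ℝ :=
  TensorialAt.mkHom _ x (tensorialAt_oneForm D hη v)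

theorem covDerivOneForm_apply (D : LinConnection I M) {η : CovField I M} (hη : SmoothOneForm η)
    {x : M} (v : TangentSpace I x) {Y : VField I M} (hY : SmoothVField Y) :
    covDerivOneForm D hη v (Y x) = mvfderiv I (fun y ↦ η y (Y y)) x v - η x (D Y x v) :=
  TensorialAt.mkHom_apply (tensorialAt_oneForm D hη v) (hY.mdifferentiableAt x)

/-- The bilinear form `S(v, w) = (∇_v η)(w) + η(v) η(A w)`. -/
def formS [T2Space M] (D : LinConnection I M) (A : EndField I M) {η : CovField I M}
    (hη : SmoothOneForm η) (x : M) : TangentSpace I x →ₗ[ℝ] TangentSpace I x →ₗ[ℝ] ℝ :=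
  LinearMap.mk₂ ℝ (fun v w ↦ covDerivOneForm D hη v w + η x v * η x (A x w))
    (fun v v' w ↦ by
      obtain ⟨W, hW, rfl⟩ := exists_smoothVField_apply_eq w
      simp [covDerivOneForm_apply D hη _ hW]; ring)
    (fun c v w ↦ by
      obtain ⟨W, hW, rfl⟩ := exists_smoothVField_apply_eq w
      simp [covDerivOneForm_apply D hη _ hW]; ring)
    (fun v w w' ↦ by simp; ring)
    (fun c v w ↦ by simp; ring)

theorem formS_apply [T2Space M] (D : LinConnection I M) (A : EndField I M) {η : CovField I M}
    (hη : SmoothOneForm η) (x : M) (v : TangentSpace I x) {Y : VField I M} (hY : SmoothVField Y) :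
    formS D A hη x v (Y x) =
      mvfderiv I (fun y ↦ η y (Y y)) x v - η x (D Y x v) + η x v * η x (A x (Y x)) := by
  rw [← covDerivOneForm_apply D hη v hY]
  rfl

end OneForm

/-! ### The connections `∇¹` and `∇²` and their curvature tensor of the fourth kind -/

section Kahler

variable [IsManifold I ∞ M]

theorem nabla_quarterSymmetric (D : LinConnection I M) (A : EndField I M) (η : CovField I M)
    (X Y : VField I M) :
    nabla (quarterSymmetric D A η) X Y =
      nabla D X Y - (fun x ↦ η x (X x)) • applyField A Y := rfl

variable [RiemannianBundle (fun x : M ↦ TangentSpace I x)]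
  {D : LinConnection I M} {A : EndField I M} {η : CovField I M}

theorem IsAlmostHermitian.even_finrank (hA : IsAlmostHermitian A) (x : M) :
    Even (Module.finrank ℝ E) :=
  even_finrank_of_sq_eq_neg (A x : TangentSpace I x →ₗ[ℝ] TangentSpace I x) (hA.sq_eq_neg x)

variable [FiniteDimensional ℝ E]

theorem IsAlmostHermitian.trace_eq_zero (hA : IsAlmostHermitian A) (x : M) :
    LinearMap.trace ℝ (TangentSpace I x) (A x : TangentSpace I x →ₗ[ℝ] TangentSpace I x) = 0 := by
  have : FiniteDimensional ℝ (TangentSpace I x) := inferInstanceAs (FiniteDimensional ℝ E)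
  refine trace_eq_zero_of_skew _ fun v w ↦ ?_
  have h := hA.inner_eq x (A x v) w
  rw [hA.sq_eq_neg, inner_neg_left] at h
  simpa using h.symm

variable [IsContMDiffRiemannianBundle I ∞ E (fun x : M ↦ TangentSpace I x)]

theorem IsLeviCivita.mlieBracket_eq (hD : IsLeviCivita D) {X Y : VField I M}
    (hX : SmoothVField X) (hY : SmoothVField Y) :
    VectorField.mlieBracket I X Y = nabla D X Y - nabla D Y X := by
  have : CompleteSpace E := FiniteDimensional.complete ℝ E
  ext x
  exact (D.torsion_eq_zero_iff.1 hD.torsion_eq_zero (hX.mdifferentiableAt x)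
    (hY.mdifferentiableAt x)).symm

/-- Torsion-freeness turns ∇_Y X + [X,Y] into ∇_X Y; passing to the dual merely swaps X and Y in the
correction term. -/
theorem nabla_dual_quarterSymmetric (hD : IsLeviCivita D) {X Y : VField I M}
    (hX : SmoothVField X) (hY : SmoothVField Y) :
    nabla (dual (quarterSymmetric D A η)) X Y =
      nabla D X Y - (fun x ↦ η x (Y x)) • applyField A X := by
  ext x
  rw [nabla_dual _ (hX.mdifferentiableAt x) (hY.mdifferentiableAt x), hD.mlieBracket_eq hX hY,
    nabla_quarterSymmetric]
  simp only [Pi.sub_apply]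
  abel

theorem nabla_quarterSymmetric_smooth (hD : IsLeviCivita D) (hA : SmoothEndField A)
    (hη : SmoothOneForm η) {X Y : VField I M} (hX : SmoothVField X) (hY : SmoothVField Y) :
    SmoothVField (nabla (quarterSymmetric D A η) X Y) := by
  rw [nabla_quarterSymmetric]
  exact (nabla_smooth hD.smooth hX hY).sub ((hA.applyField hY).smul (hη.contMDiff_apply hX))

theorem nabla_dual_quarterSymmetric_smooth (hD : IsLeviCivita D) (hA : SmoothEndField A)
    (hη : SmoothOneForm η) {X Y : VField I M} (hX : SmoothVField X) (hY : SmoothVField Y) :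
    SmoothVField (nabla (dual (quarterSymmetric D A η)) X Y) := by
  rw [nabla_dual_quarterSymmetric hD hX hY]
  exact (nabla_smooth hD.smooth hX hY).sub ((hA.applyField hX).smul (hη.contMDiff_apply hY))

theorem curvature4_congr (hD : IsLeviCivita D) (hA : SmoothEndField A) (hη : SmoothOneForm η)
    {X X' Y Y' Z Z' : VField I M} {x : M} (hX : SmoothVField X') (hY : SmoothVField Y')
    (hZ : SmoothVField Z') (hXX' : X =ᶠ[𝓝 x] X') (hYY' : Y =ᶠ[𝓝 x] Y') (hZZ' : Z =ᶠ[𝓝 x] Z') :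
    curvature4 (quarterSymmetric D A η) X Y Z x = curvature4 (quarterSymmetric D A η) X' Y' Z' x := by
  have h1 {U V : VField I M} (hU : SmoothVField U) (hV : SmoothVField V) :=
    nabla_quarterSymmetric_smooth hD hA hη hU hV
  have h2 {U V : VField I M} (hU : SmoothVField U) (hV : SmoothVField V) :=
    nabla_dual_quarterSymmetric_smooth hD hA hη hU hV
  simp only [curvature4, Pi.add_apply, Pi.sub_apply]
  rw [(nabla_congr _ (h1 hY hZ) hXX' (nabla_congr _ hZ hYY' hZZ')).self_of_nhds,
    (nabla_congr _ (h2 hX hZ) hYY' (nabla_congr _ hZ hXX' hZZ')).self_of_nhds,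
    (nabla_congr _ hZ (nabla_congr _ hX hYY' hXX') hZZ').self_of_nhds,
    (nabla_congr _ hZ (nabla_congr _ hY hXX' hYY') hZZ').self_of_nhds]

theorem curvature_congr (hD : IsLeviCivita D)
    {X X' Y Y' Z Z' : VField I M} {x : M} (hX : SmoothVField X') (hY : SmoothVField Y')
    (hZ : SmoothVField Z') (hXX' : X =ᶠ[𝓝 x] X') (hYY' : Y =ᶠ[𝓝 x] Y') (hZZ' : Z =ᶠ[𝓝 x] Z') :
    curvature D X Y Z x = curvature D X' Y' Z' x := by
  have h1 {U V : VField I M} (hU : SmoothVField U) (hV : SmoothVField V) :=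
    nabla_smooth hD.smooth hU hV
  simp only [curvature, Pi.sub_apply]
  rw [(nabla_congr _ (h1 hY hZ) hXX' (nabla_congr _ hZ hYY' hZZ')).self_of_nhds,
    (nabla_congr _ (h1 hX hZ) hYY' (nabla_congr _ hZ hXX' hZZ')).self_of_nhds,
    (nabla_congr _ hZ (hXX'.mlieBracket_vectorField hYY') hZZ').self_of_nhds]

/-- The curvature operators of a metric connection are skew-symmetric. -/
theorem IsLeviCivita.inner_curvature [T2Space M] (hD : IsLeviCivita D) {X Y U V : VField I M}
    (hX : SmoothVField X) (hY : SmoothVField Y) (hU : SmoothVField U) (hV : SmoothVField V)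
    (x : M) :
    inner ℝ (curvature D X Y U x) (V x) = -inner ℝ (U x) (curvature D X Y V x) := by
  have hs {P Q : VField I M} (hP : SmoothVField P) (hQ : SmoothVField Q) :
      ContMDiff I 𝓘(ℝ) ∞ fun y ↦ (inner ℝ (P y) (Q y) : ℝ) :=
    ContMDiff.inner_bundle (F := E) (E := fun x : M ↦ TangentSpace I x) (b := id) hP hQ
  have hmd {P Q : VField I M} (hP : SmoothVField P) (hQ : SmoothVField Q) (y : M) :
      MDifferentiableAt I 𝓘(ℝ) (fun y ↦ (inner ℝ (P y) (Q y) : ℝ)) y :=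
    (hs hP hQ).contMDiffAt.mdifferentiableAt (by simp)
  have hd (W : VField I M) {P Q : VField I M} (hP : SmoothVField P) (hQ : SmoothVField Q) (y : M) :
      mvfderiv I (fun y ↦ (inner ℝ (P y) (Q y) : ℝ)) y (W y) =
        inner ℝ (nabla D W P y) (Q y) + inner ℝ (P y) (nabla D W Q y) :=
    hD.metric.mvfderiv_inner_eq W (hP.mdifferentiableAt y) (hQ.mdifferentiableAt y)
  have hn {W P : VField I M} (hW : SmoothVField W) (hP : SmoothVField P) :=
    nabla_smooth hD.smooth hW hP
  have hf {W : VField I M} : (fun y ↦ mvfderiv I (fun y ↦ (inner ℝ (U y) (V y) : ℝ)) y (W y)) =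
      (fun y ↦ (inner ℝ (nabla D W U y) (V y) : ℝ)) + fun y ↦ inner ℝ (U y) (nabla D W V y) := by
    ext y; exact hd W hU hV y
  -- Metric compatibility writes W⟨U,V⟩ through inner products of smooth fields, which gives its
  -- smoothness.
  have hfs {W : VField I M} (hW : SmoothVField W) : ContMDiff I 𝓘(ℝ) ∞
      fun y ↦ mvfderiv I (fun y ↦ (inner ℝ (U y) (V y) : ℝ)) y (W y) := by
    rw [hf]
    exact (hs (hn hW hU) hV).add (hs hU (hn hW hV))
  -- Expand [X,Y]⟨U,V⟩ = XY⟨U,V⟩ - YX⟨U,V⟩ by metric compatibility; the mixed terms ⟨∇_X U, ∇_Y V⟩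
  -- and ⟨∇_Y U, ∇_X V⟩ cancel.
  have h := mvfderiv_mlieBracket hX hY (hs hU hV) (hfs hX) (hfs hY) x
  rw [hf, hf, mvfderiv_add (hmd (hn hY hU) hV x) (hmd hU (hn hY hV) x),
    mvfderiv_add (hmd (hn hX hU) hV x) (hmd hU (hn hX hV) x)] at h
  simp only [add_apply] at h
  rw [hd _ hU hV, hd _ (hn hY hU) hV, hd _ hU (hn hY hV), hd _ (hn hX hU) hV,
    hd _ hU (hn hX hV)] at h
  simp only [curvature, Pi.sub_apply, inner_sub_left, inner_sub_right]
  linarith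

/-- Parallelism moves A out of every derivative. Derivatives of η(Y) and η(Z) pair with η(∇_X Y) and
η(∇_Y Z) to form ∇η; the two terms η(X) ∇_{AY} Z cancel; A² = -1 produces the terms in X and Y. -/
theorem curvature4_quarterSymmetric [T2Space M] (hK : IsKahler D A) (hη : SmoothOneForm η)
    {X Y Z : VField I M} (hX : SmoothVField X) (hY : SmoothVField Y) (hZ : SmoothVField Z) (x : M) :
    curvature4 (quarterSymmetric D A η) X Y Z x =
      curvature D X Y Z x - formS D A hη x (X x) (Y x) • A x (Z x)
        + formS D A hη x (Y x) (Z x) • A x (X x)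
        + (η x (Y x) * η x (Z x)) • X x - (η x (X x) * η x (Z x)) • Y x := by
  have hD := hK.leviCivita
  have hA := hK.almostHermitian.smooth
  have hn {W P : VField I M} (hW : SmoothVField W) (hP : SmoothVField P) :=
    nabla_smooth hD.smooth hW hP
  have e1 := nabla_dual_quarterSymmetric (A := A) (η := η) hD hX
    (nabla_quarterSymmetric_smooth hD hA hη hY hZ)
  have e2 := nabla_quarterSymmetric D A η Y (nabla (dual (quarterSymmetric D A η)) X Z)
  have e3 := nabla_dual_quarterSymmetric (A := A) (η := η) hD
    (nabla_dual_quarterSymmetric_smooth hD hA hη hY hX) hZ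
  rw [nabla_quarterSymmetric, nabla_sub_right D _ (hn hY hZ)
    ((hA.applyField hZ).smul (hη.contMDiff_apply hY)),
    nabla_smul_right D _ (hη.contMDiff_apply hY) (hA.applyField hZ), hK.parallel X Z hX hZ] at e1
  rw [nabla_dual_quarterSymmetric hD hX hZ, nabla_sub_right D _ (hn hX hZ)
    ((hA.applyField hX).smul (hη.contMDiff_apply hZ)),
    nabla_smul_right D _ (hη.contMDiff_apply hZ) (hA.applyField hX), hK.parallel Y X hY hX] at e2
  rw [nabla_dual_quarterSymmetric hD hY hX] at e3
  rw [formS_apply _ _ _ _ _ hY, formS_apply _ _ _ _ _ hZ]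
  simp only [curvature4, curvature, Pi.add_apply, Pi.sub_apply]
  rw [nabla_dual_quarterSymmetric hD hX hZ, nabla_quarterSymmetric D A η Y Z, e1, e2,
    nabla_dual_quarterSymmetric hD hY hX, e3,
    nabla_quarterSymmetric D A η _ Z, nabla_quarterSymmetric D A η X Y, hD.mlieBracket_eq hX hY]
  simp only [nabla, applyField, Pi.sub_apply, Pi.add_apply, Pi.smul_apply',
    map_sub, map_smul, hK.almostHermitian.sq_eq_neg, smul_eq_mul]
  module

/-- In the trace over Z, R(X,Y) and A contribute nothing and the two η ⊗ η terms both give η(X)η(Y)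
with opposite signs; only S(Y,·) ⊗ AX survives. -/
theorem primeContraction_curvature4 [T2Space M] (hK : IsKahler D A) (hη : SmoothOneForm η)
    {X Y : VField I M} (hX : SmoothVField X) (hY : SmoothVField Y) (x : M) :
    primeContraction (curvature4 (quarterSymmetric D A η)) X Y x =
      formS D A hη x (Y x) (A x (X x)) := by
  have hD := hK.leviCivita
  have : FiniteDimensional ℝ (TangentSpace I x) := inferInstanceAs (FiniteDimensional ℝ E)
  have hl : LocalAt (fun Z ↦ curvature D X Y Z) x := fun U U' hU h ↦
    curvature_congr hD hX hY hU .rfl .rfl h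
  rw [primeContraction, traceAt_eq_add (Ψ := fun Z ↦ curvature D X Y Z)
    (fun U U' hU h ↦ curvature4_congr hD hK.almostHermitian.smooth hη hX hY hU .rfl .rfl h) hl
    (-formS D A hη x (X x) (Y x) • (A x : TangentSpace I x →ₗ[ℝ] TangentSpace I x)
      + (formS D A hη x (Y x)).smulRight (A x (X x))
      + (η x (Y x) • (η x : TangentSpace I x →ₗ[ℝ] ℝ)).smulRight (X x)
      - (η x (X x) • (η x : TangentSpace I x →ₗ[ℝ] ℝ)).smulRight (Y x)) fun U hU ↦ ?_,
    traceAt_eq_zero_of_skew hl fun U V hU hV ↦ hD.inner_curvature hX hY hU hV x]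
  · simp only [map_add, map_sub, map_smul, LinearMap.trace_smulRight,
      hK.almostHermitian.trace_eq_zero]
    simp
    ring
  · rw [curvature4_quarterSymmetric hK hη hX hY hU]
    simp
    module

/-- In the factor n-1, the n is the trace of the identity in η(Y)η(Z) X, and the -1 comes from the
rank-one term X ↦ η(X)η(Z) Y. -/
theorem ricci_curvature4 [T2Space M] (hK : IsKahler D A) (hη : SmoothOneForm η)
    {Y Z : VField I M} (hY : SmoothVField Y) (hZ : SmoothVField Z) (x : M) :
    ricci (curvature4 (quarterSymmetric D A η)) Y Z x =
      ricci (curvature D) Y Z x - formS D A hη x (A x (Z x)) (Y x)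
        + (Module.finrank ℝ E - 1) * (η x (Y x) * η x (Z x)) := by
  have hD := hK.leviCivita
  have : FiniteDimensional ℝ (TangentSpace I x) := inferInstanceAs (FiniteDimensional ℝ E)
  have hE : Module.finrank ℝ (TangentSpace I x) = Module.finrank ℝ E := rfl
  rw [ricci, traceAt_eq_add (Ψ := fun X ↦ curvature D X Y Z)
    (fun U U' hU h ↦ curvature4_congr hD hK.almostHermitian.smooth hη hU hY hZ h .rfl .rfl)
    (fun U U' hU h ↦ curvature_congr hD hU hY hZ h .rfl .rfl)
    (-((formS D A hη x).flip (Y x)).smulRight (A x (Z x))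
      + formS D A hη x (Y x) (Z x) • (A x : TangentSpace I x →ₗ[ℝ] TangentSpace I x)
      + (η x (Y x) * η x (Z x)) • LinearMap.id
      - (η x (Z x) • (η x : TangentSpace I x →ₗ[ℝ] ℝ)).smulRight (Y x)) fun U hU ↦ ?_, ricci]
  · simp only [map_add, map_sub, map_neg, map_smul, LinearMap.trace_smulRight, LinearMap.trace_id,
      hK.almostHermitian.trace_eq_zero, hE]
    simp
    ring
  · rw [curvature4_quarterSymmetric hK hη hU hY hZ]
    simp
    module

theorem tensorH4_eq_weylProjective [T2Space M] (hK : IsKahler D A) (hη : SmoothOneForm η)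
    {X Y Z : VField I M} (hX : SmoothVField X) (hY : SmoothVField Y) (hZ : SmoothVField Z) :
    tensorH4 (quarterSymmetric D A η) A X Y Z = weylProjective D X Y Z := by
  ext x
  have hA := hK.almostHermitian
  -- The dimension is even, so it is not 1.
  have hn : (Module.finrank ℝ E : ℝ) - 1 ≠ 0 := by
    rw [sub_ne_zero]
    intro h
    have h1 : Module.finrank ℝ E = 1 := by exact_mod_cast h
    simpa [h1] using hA.even_finrank x
  simp only [tensorH4, weylProjective, Pi.add_apply, Pi.sub_apply, Pi.smul_apply, Pi.smul_apply']
  rw [curvature4_quarterSymmetric hK hη hX hY hZ, ricci_curvature4 hK hη hY hZ,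
    ricci_curvature4 hK hη hX hZ,
    primeContraction_curvature4 hK hη (hA.smooth.applyField hY) hX,
    primeContraction_curvature4 hK hη (hA.smooth.applyField hZ) hY,
    primeContraction_curvature4 hK hη (hA.smooth.applyField hY) (hA.smooth.applyField hZ),
    primeContraction_curvature4 hK hη (hA.smooth.applyField hX) (hA.smooth.applyField hZ)]
  -- A² = -1 turns each 'R⁴ with first argument AY, AZ or AX into minus a value of S, and all S
  -- terms then cancel.
  simp only [applyField, hA.sq_eq_neg, map_neg]
  match_scalars <;> field_simp <;> ring

end Kahler

end QuarterSymmetric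

end

theorem mainTheorem2 {n : ℕ} {M : Type*} [TopologicalSpace M] [T2Space M]
    [ChartedSpace (EuclideanSpace ℝ (Fin n)) M] [IsManifold (𝓡 n) ∞ M]
    [RiemannianBundle (fun x : M ↦ TangentSpace (𝓡 n) x)]
    [IsContMDiffRiemannianBundle (𝓡 n) ∞ (EuclideanSpace ℝ (Fin n))
      (fun x : M ↦ TangentSpace (𝓡 n) x)]
    (D : QuarterSymmetric.LinConnection (𝓡 n) M) (A : QuarterSymmetric.EndField (𝓡 n) M)
    (hK : QuarterSymmetric.IsKahler D A) :
    (∀ η η' : QuarterSymmetric.CovField (𝓡 n) M,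
      QuarterSymmetric.SmoothOneForm η → QuarterSymmetric.SmoothOneForm η' →
      ∀ X Y Z : QuarterSymmetric.VField (𝓡 n) M,
        QuarterSymmetric.SmoothVField X → QuarterSymmetric.SmoothVField Y →
        QuarterSymmetric.SmoothVField Z →
        QuarterSymmetric.tensorH4 (QuarterSymmetric.quarterSymmetric D A η) A X Y Z =
          QuarterSymmetric.tensorH4 (QuarterSymmetric.quarterSymmetric D A η') A X Y Z) ∧
    (∀ η : QuarterSymmetric.CovField (𝓡 n) M, QuarterSymmetric.SmoothOneForm η →
      ∀ X Y Z : QuarterSymmetric.VField (𝓡 n) M,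
        QuarterSymmetric.SmoothVField X → QuarterSymmetric.SmoothVField Y →
        QuarterSymmetric.SmoothVField Z →
        QuarterSymmetric.tensorH4 (QuarterSymmetric.quarterSymmetric D A η) A X Y Z =
          QuarterSymmetric.weylProjective D X Y Z) := by
  have h := fun η (hη : QuarterSymmetric.SmoothOneForm η) X Y Z hX hY hZ ↦
    QuarterSymmetric.tensorH4_eq_weylProjective hK hη (X := X) (Y := Y) (Z := Z) hX hY hZ
  exact ⟨fun η η' hη hη' X Y Z hX hY hZ ↦
    (h η hη X Y Z hX hY hZ).trans (h η' hη' X Y Z hX hY hZ).symm, h⟩
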